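/- Let $K$ be an arbitrary field and let $E=K^2$ be the natural $2$-dimensional representation of $\mathrm{SL}_2(K)$. For a finite-dimensional representation $V$ of a group $G$ over $K$ and $r\ge 0$, let $S_r$ act on $V^{\otimes r}$ by place permutation. Write $\mathrm{Sym}^r V$ for the coinvariants of this action (the quotient of $V^{\otimes r}$ by the span of all $w\cdot\sigma-w$) and $\mathrm{Sym}_r V=(V^{\otimes r})^{S_r}$ for the invariants, each with the action of $G$ induced by the diagonal action on $V^{\otimes r}$. For a partition $\lambda$ with $k$ (positive) parts, let $\mathrm{Sym}^\lambda V=\mathrm{Sym}^{\lambda_1}V\otimes\cdots\otimes\mathrm{Sym}^{\lambda_k}V$. Fix a basis $(v_b)_{b\in\mathcal B}$ of $V$. For a $\lambda$-tableau $t\colon[\lambda]\to\mathcal B$ set $$\mathbf e(t)=\sum_{\sigma}\operatorname{sgn}(\sigma)\bigotimes_{i=1}^{k}\prod_{j=1}^{\lambda_i}v_{(t\cdot\sigma)(i,j)}\in\mathrm{Sym}^\lambda V,$$ the sum being over all permutations $\sigma$ of the boxes of the Young diagram $[\lambda]$ that preserve each column, where $t\cdot\sigma$ is obtained from $t$ by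 place permutation. Let $\nabla^\lambda V\subseteq \mathrm{Sym}^\lambda V$ be the subrepresentation spanned by all $\mathbf e(t)$; it does not depend on the choice of basis. Let $\ell,s\ge 0$ be integers and let $\lambda$ be a partition with at most $\ell+1$ parts and with first part at most $s$. Let $\lambda^\circ$ be the complement of $\lambda$ in the rectangle with $\ell+1$ rows and $s$ columns; that is, $\lambda^\circ_i=s-\lambda_{\ell+2-i}$ for $1\le i\le \ell+1$, where $\lambda$ is padded by zeros to have $\ell+1$ parts. Then there is an isomorphism of representations of $\mathrm{SL}_2(K)$ over $K$ $$\nabla^\lambda\,\mathrm{Sym}^\ell E\;\cong\;\nabla^{\lambda^\circ}\,\mathrm{Sym}_\ell E .$$ -/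

import Mathlib

open scoped TensorProduct

noncomputable section

namespace ModularPlethysm

/-! ### The natural representation and the two symmetric powers -/

/-- The natural `2`-dimensional representation `E` of `SL₂(K)` on column vectors. -/
def naturalRep (K : Type*) [Field K] :
    Representation K (Matrix.SpecialLinearGroup (Fin 2) K) (Fin 2 → K) where
  toFun g := Matrix.toLin' (g : Matrix (Fin 2) (Fin 2) K)
  map_one' := by
    rw [Matrix.SpecialLinearGroup.coe_one, Matrix.toLin'_one]
    rfl
  map_mul' g h := by simp [Matrix.toLin'_mul, Module.End.mul_eq_comp]

/-- The place permutation action of the symmetric group on `V^{⊗r}`: `σ` sends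
`v₁ ⊗ ⋯ ⊗ vᵣ` to the tensor whose factor in place `i` is the old factor in place `σ⁻¹ i`. -/
def placePerm (K : Type*) [Field K] (V : Type*) [AddCommGroup V] [Module K V] (r : ℕ) :
    Representation K (Equiv.Perm (Fin r)) (⨂[K]^r V) where
  toFun σ := (PiTensorProduct.reindex K (fun _ : Fin r => V) σ).toLinearMap
  map_one' := by
    ext t
    simp
    rfl
  map_mul' σ τ := by
    ext t
    simp [PiTensorProduct.reindex_tprod]
    rfl

theorem placePerm_tprod (K : Type*) [Field K] (V : Type*) [AddCommGroup V] [Module K V] (r : ℕ)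
    (σ : Equiv.Perm (Fin r)) (v : Fin r → V) :
    placePerm K V r σ (PiTensorProduct.tprod K v) =
      PiTensorProduct.tprod K (fun i => v (σ.symm i)) :=
  PiTensorProduct.reindex_tprod σ v

/-- The upper symmetric power `Sym^r V`: the coinvariants of the place permutation action, that is,
the quotient of `V^{⊗r}` by the span of all `w · σ - w`. -/
abbrev SymUpper (K : Type*) [Field K] (V : Type*) [AddCommGroup V] [Module K V] (r : ℕ) : Type _ :=
  (placePerm K V r).Coinvariants

/-- The lower symmetric power `Sym_r V`: the invariants of the place permutation action. -/
abbrev SymLower (K : Type*) [Field K] (V : Type*) [AddCommGroup V] [Module K V] (r : ℕ) :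
    Submodule K (⨂[K]^r V) :=
  (placePerm K V r).invariants

/-- The diagonal action of `G` on `V^{⊗r}`. -/
def tensorPowerRep {K G V : Type*} [Field K] [Group G] [AddCommGroup V] [Module K V]
    (ρ : Representation K G V) (r : ℕ) : Representation K G (⨂[K]^r V) where
  toFun g := PiTensorProduct.map (fun _ : Fin r => ρ g)
  map_one' := by simp
  map_mul' g h := by
    simpa using PiTensorProduct.map_mul (fun _ : Fin r => ρ g) (fun _ : Fin r => ρ h)

theorem tensorPowerRep_tprod {K G V : Type*} [Field K] [Group G] [AddCommGroup V] [Module K V]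
    (ρ : Representation K G V) (r : ℕ) (g : G) (v : Fin r → V) :
    tensorPowerRep ρ r g (PiTensorProduct.tprod K v) =
      PiTensorProduct.tprod K (fun i => ρ g (v i)) :=
  PiTensorProduct.map_tprod _ _

theorem tensorPowerRep_placePerm {K G V : Type*} [Field K] [Group G] [AddCommGroup V] [Module K V]
    (ρ : Representation K G V) (r : ℕ) (g : G) (σ : Equiv.Perm (Fin r)) (w : ⨂[K]^r V) :
    tensorPowerRep ρ r g (placePerm K V r σ w) = placePerm K V r σ (tensorPowerRep ρ r g w) := by
  have h : tensorPowerRep ρ r g ∘ₗ placePerm K V r σ =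
      placePerm K V r σ ∘ₗ tensorPowerRep ρ r g := by
    refine PiTensorProduct.ext (MultilinearMap.ext fun v => ?_)
    simp only [LinearMap.compMultilinearMap_apply, LinearMap.comp_apply]
    rw [placePerm_tprod, tensorPowerRep_tprod, tensorPowerRep_tprod, placePerm_tprod]
  exact LinearMap.congr_fun h w

/-- The action of `G` on `Sym^r V` induced by the diagonal action on `V^{⊗r}`. -/
def symUpperRep {K G V : Type*} [Field K] [Group G] [AddCommGroup V] [Module K V]
    (ρ : Representation K G V) (r : ℕ) : Representation K G (SymUpper K V r) :=
  (tensorPowerRep ρ r).quotient (Representation.Coinvariants.ker (placePerm K V r)) (by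
    intro g
    refine Submodule.span_le.2 ?_
    rintro _ ⟨⟨σ, w⟩, rfl⟩
    refine Submodule.subset_span ⟨(σ, tensorPowerRep ρ r g w), ?_⟩
    simp [tensorPowerRep_placePerm])

/-- The action of `G` on `Sym_r V` obtained by restricting the diagonal action on `V^{⊗r}`. -/
def symLowerRep {K G V : Type*} [Field K] [Group G] [AddCommGroup V] [Module K V]
    (ρ : Representation K G V) (r : ℕ) : Representation K G (SymLower K V r) :=
  (tensorPowerRep ρ r).subrepresentation (SymLower K V r) (by
    intro g w hw σ
    rw [← tensorPowerRep_placePerm, hw σ])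

/-- The product `v₁ ⋯ vᵣ` in `Sym^r V`: the image of `v₁ ⊗ ⋯ ⊗ vᵣ`. -/
def symProd (K : Type*) [Field K] {V : Type*} [AddCommGroup V] [Module K V] (r : ℕ) :
    MultilinearMap K (fun _ : Fin r => V) (SymUpper K V r) :=
  (Representation.Coinvariants.mk (placePerm K V r)).compMultilinearMap (PiTensorProduct.tprod K)

theorem symUpperRep_symProd {K G V : Type*} [Field K] [Group G] [AddCommGroup V] [Module K V]
    (ρ : Representation K G V) (r : ℕ) (g : G) (v : Fin r → V) :
    symUpperRep ρ r g (symProd K r v) = symProd K r (fun i => ρ g (v i)) :=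
  congrArg (Representation.Coinvariants.mk (placePerm K V r)) (tensorPowerRep_tprod ρ r g v)

/-! ### Schur functors

A partition is given by its Young diagram `μ` (in the English convention, with rows and columns
indexed from `0`); its parts are `μ.rowLen i` for `i < μ.colLen 0`, so `μ.colLen 0` is the number of
parts and `μ.rowLen 0` is the largest part. -/

/-- `Sym^μ V = Sym^{μ₁} V ⊗ ⋯ ⊗ Sym^{μ_k} V`, where `k` is the number of parts of `μ`. -/
abbrev SymPartition (K : Type*) [Field K] (V : Type*) [AddCommGroup V] [Module K V]
    (μ : YoungDiagram) : Type _ :=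
  ⨂[K] i : Fin (μ.colLen 0), SymUpper K V (μ.rowLen i)

/-- The action of `G` on `Sym^μ V`. -/
def symPartitionRep {K G V : Type*} [Field K] [Group G] [AddCommGroup V] [Module K V]
    (ρ : Representation K G V) (μ : YoungDiagram) : Representation K G (SymPartition K V μ) where
  toFun g := PiTensorProduct.map (fun i : Fin (μ.colLen 0) => symUpperRep ρ (μ.rowLen i) g)
  map_one' := by simp
  map_mul' g h := by
    simpa using PiTensorProduct.map_mul
      (fun i : Fin (μ.colLen 0) => symUpperRep ρ (μ.rowLen i) g)
      (fun i : Fin (μ.colLen 0) => symUpperRep ρ (μ.rowLen i) h)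

/-- The box of `μ` in row `i` and column `j`. -/
def box (μ : YoungDiagram) (i : Fin (μ.colLen 0)) (j : Fin (μ.rowLen i)) : μ.cells :=
  ⟨((i : ℕ), (j : ℕ)), YoungDiagram.mem_iff_lt_rowLen.2 j.2⟩

/-- The element `⨂ᵢ ∏ⱼ t(i,j)` of `Sym^μ V` attached to a `μ`-tableau `t` with entries
from `V`. -/
def rowTensor (K : Type*) [Field K] {V : Type*} [AddCommGroup V] [Module K V]
    (μ : YoungDiagram) (t : μ.cells → V) : SymPartition K V μ :=
  PiTensorProduct.tprod K fun i => symProd K (μ.rowLen i) fun j => t (box μ i j)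

/-- The group of permutations of the boxes of `μ` that permute amongst themselves
the boxes in each column. -/
def columnPerms (μ : YoungDiagram) : Finset (Equiv.Perm μ.cells) :=
  {σ | ∀ c, (σ c).1.2 = c.1.2}

/-- The polytabloid `e(t) = ∑_σ sgn(σ) ⨂ᵢ ∏ⱼ (t · σ)(i,j)`, the sum being over all
column-preserving place permutations `σ`. -/
def polytabloid (K : Type*) [Field K] {V : Type*} [AddCommGroup V] [Module K V]
    (μ : YoungDiagram) (t : μ.cells → V) : SymPartition K V μ :=
  ∑ σ ∈ columnPerms μ, Equiv.Perm.sign σ • rowTensor K μ (fun c => t (σ.symm c))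

/-- The Schur functor `∇^μ V`: the subspace of `Sym^μ V` spanned by the polytabloids `e(t)`.
The entries of `t` are arbitrary vectors; the theorem `schur_eq_span_basis` below shows that tableaux
with entries in a fixed basis of `V` span the same subspace. -/
def schur (K : Type*) [Field K] (V : Type*) [AddCommGroup V] [Module K V]
    (μ : YoungDiagram) : Submodule K (SymPartition K V μ) :=
  Submodule.span K (Set.range (polytabloid K μ (V := V)))

theorem symPartitionRep_polytabloid {K G V : Type*} [Field K] [Group G] [AddCommGroup V]
    [Module K V] (ρ : Representation K G V) (μ : YoungDiagram) (g : G) (t : μ.cells → V) :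
    symPartitionRep ρ μ g (polytabloid K μ t) = polytabloid K μ (fun c => ρ g (t c)) := by
  have h (u : μ.cells → V) :
      symPartitionRep ρ μ g (rowTensor K μ u) = rowTensor K μ (fun c => ρ g (u c)) := by
    refine (PiTensorProduct.map_tprod _ _).trans ?_
    simp only [symUpperRep_symProd]
    rfl
  simp only [polytabloid, map_sum, Units.smul_def, map_zsmul, h]

/-- The action of `G` on `∇^μ V`, restricted from `Sym^μ V`. -/
def schurRep {K G V : Type*} [Field K] [Group G] [AddCommGroup V] [Module K V]
    (μ : YoungDiagram) (ρ : Representation K G V) : Representation K G (schur K V μ) :=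
  (symPartitionRep ρ μ).subrepresentation (schur K V μ) (by
    intro g
    refine Submodule.span_le.2 ?_
    rintro _ ⟨t, rfl⟩
    exact Submodule.subset_span ⟨_, (symPartitionRep_polytabloid ρ μ g t).symm⟩)

/-- The element `rowTensor K μ t` is multilinear in the entries of `t`. -/
def rowTensorMultilinear (K : Type*) [Field K] (V : Type*) [AddCommGroup V] [Module K V]
    (μ : YoungDiagram) : MultilinearMap K (fun _ : μ.cells => V) (SymPartition K V μ) :=
  have key [DecidableEq μ.cells] (t : μ.cells → V) (c : μ.cells) :
      ∃ (i : Fin (μ.colLen 0)) (j : Fin (μ.rowLen i)), ∀ x : V,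
        rowTensor K μ (Function.update t c x) =
          PiTensorProduct.tprod K (Function.update
            (fun i' : Fin (μ.colLen 0) => symProd K (μ.rowLen i') fun j' => t (box μ i' j')) i
            (symProd K (μ.rowLen i) (Function.update (fun j' => t (box μ i j')) j x))) := by
    obtain ⟨⟨a, b⟩, hc⟩ := c
    have hb : b < μ.rowLen a := YoungDiagram.mem_iff_lt_rowLen.1 hc
    have ha : a < μ.colLen 0 :=
      YoungDiagram.mem_iff_lt_colLen.1 (μ.up_left_mem le_rfl (Nat.zero_le b) hc)
    refine ⟨⟨a, ha⟩, ⟨b, hb⟩, fun x => ?_⟩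
    unfold rowTensor
    congr 1
    funext i'
    by_cases hi : i' = ⟨a, ha⟩
    · subst hi
      rw [Function.update_self]
      congr 1
      funext j'
      by_cases hj : j' = ⟨b, hb⟩
      · subst hj
        rw [Function.update_self]
        exact Function.update_self _ _ _
      · rw [Function.update_of_ne hj, Function.update_of_ne]
        intro h
        exact hj (Fin.ext (congrArg (fun c => c.1.2) h))
    · rw [Function.update_of_ne hi]
      congr 1
      funext j'
      rw [Function.update_of_ne]
      intro h
      exact hi (Fin.ext (congrArg (fun c => c.1.1) h))
  { toFun := rowTensor K μ
    map_update_add' := by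
      intro _ t c x y
      obtain ⟨i, j, h⟩ := key t c
      rw [h, h, h, MultilinearMap.map_update_add, MultilinearMap.map_update_add]
    map_update_smul' := by
      intro _ t c a x
      obtain ⟨i, j, h⟩ := key t c
      rw [h, h, MultilinearMap.map_update_smul, MultilinearMap.map_update_smul] }

/-- For any basis of `V`, the space `∇^μ V` is spanned by the polytabloids `e(t)` for tableaux `t`
with entries from that basis. -/
theorem schur_eq_span_basis (K : Type*) [Field K] (V : Type*) [AddCommGroup V] [Module K V]
    (μ : YoungDiagram) {B : Type*} (b : Module.Basis B K V) :
    schur K V μ =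
      Submodule.span K (Set.range fun t : μ.cells → B => polytabloid K μ fun c => b (t c)) := by
  refine le_antisymm (Submodule.span_le.2 ?_) (Submodule.span_mono ?_)
  · rintro _ ⟨t, rfl⟩
    set S := Submodule.span K
      (Set.range fun t : μ.cells → B => polytabloid K μ fun c => b (t c)) with hS
    let f : MultilinearMap K (fun _ : μ.cells => V) (SymPartition K V μ) :=
      ∑ σ ∈ columnPerms μ,
        Equiv.Perm.sign σ • (rowTensorMultilinear K V μ).domDomCongr σ.symm
    have hf (u : μ.cells → V) : f u = polytabloid K μ u := by
      simp only [f, sum_apply, polytabloid]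
      rfl
    have h0 : S.mkQ.compMultilinearMap f = 0 := by
      refine Module.Basis.ext_multilinear (fun _ => b) fun v => ?_
      rw [LinearMap.compMultilinearMap_apply, hf, zero_apply,
        Submodule.mkQ_apply, Submodule.Quotient.mk_eq_zero]
      exact Submodule.subset_span ⟨v, rfl⟩
    have h1 := congrArg (fun m => m t) h0
    simpa [hf] using h1
  · rintro _ ⟨t, rfl⟩
    exact ⟨_, rfl⟩

/-! ### Complements in a rectangle -/

/-- The complement `μ°` of `μ` in the rectangle with `d` rows and `s` columns: remove `μ` from
the rectangle and rotate what remains by a half-turn. -/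
def complement (μ : YoungDiagram) (d s : ℕ) : YoungDiagram where
  cells := {c ∈ Finset.range d ×ˢ Finset.range s | (d - 1 - c.1, s - 1 - c.2) ∉ μ}
  isLowerSet := by
    rintro ⟨i, j⟩ ⟨i', j'⟩ ⟨hi, hj⟩ h
    simp only [Finset.coe_filter, Finset.mem_product, Finset.mem_range, Set.mem_ofPred_eq] at h ⊢
    simp only at hi hj
    refine ⟨⟨by omega, by omega⟩, fun h' => h.2 ?_⟩
    exact μ.up_left_mem (by omega) (by omega) h'

/-- The parts of `μ°` are `s - μ_d, …, s - μ_1`, where `μ` is padded by zeros to have `d` parts. -/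
theorem rowLen_complement (μ : YoungDiagram) (d s i : ℕ) (hi : i < d) :
    (complement μ d s).rowLen i = s - μ.rowLen (d - 1 - i) := by
  refine eq_of_forall_lt_iff fun j => ?_
  rw [← YoungDiagram.mem_iff_lt_rowLen, ← YoungDiagram.mem_cells]
  simp only [complement, Finset.mem_filter, Finset.mem_product, Finset.mem_range,
    YoungDiagram.mem_iff_lt_rowLen]
  omega

end ModularPlethysm

end

/-! Put d = ℓ + 1, the dimension of V = Sym^ℓ E. The isomorphism is the composite of ∇^μ V ≅ ∇^{μ°}
V^*, valid for every d-dimensional representation of determinant 1, with Sym_ℓ E ≅ (Sym^ℓ E)^*.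

For the first, realize both sides in one commutative ring A, the coordinate ring of GL_d, with
generic matrix X. Sending an entry v in row i of a tableau to the linear form with coefficients the
i-th row of X, and multiplying, embeds Sym^μ V in A (`rowEval_rowForms_injective`). A polytabloid
becomes a product over the columns of minors of X on its top rows (`rowEval_polytabloid`). Jacobi's
complementary minor theorem (`exists_topMinor_eq`) replaces a minor on the top a rows by ± det X
times a minor of the inverse transpose on the complementary rows. Reversing the rows (`rotInv`)
makes these the top d - a rows, so column lengths turn into those of μ°. Over s columns, empty ones
included, the images of the two Schur functors differ by the factor (det X)^s (`minorSpan_eq`).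

For equivariance, g acts through the endomorphism X ↦ XP of A, with P the matrix of g on V. It
multiplies `rotInv X` on the right by the inverse transpose of P, the matrix of g on V^*, and fixes
det X when det P = 1. The determinant is 1 because SL₂(K) has no nontrivial character into K, even
for K of order 2 or 3, when the group is not perfect.

The second isomorphism holds because E is self-dual through the determinant form, and duality
exchanges invariants and coinvariants. -/

noncomputable section

namespace ModularPlethysm

/-! ### Symmetric powers and row-wise evaluation of tableaux -/

section SymmetricPower

variable {K : Type*} [Field K] {V : Type*} [AddCommGroup V] [Module K V]
  {A : Type*} [CommRing A] [Algebra K A]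

theorem symProd_comp_perm {r : ℕ} (σ : Equiv.Perm (Fin r)) (v : Fin r → V) :
    symProd K r (fun i => v (σ i)) = symProd K r v := by
  have h := placePerm_tprod K V r σ.symm v
  rw [Equiv.symm_symm] at h
  change Representation.Coinvariants.mk (placePerm K V r) (PiTensorProduct.tprod K _) = _
  rw [← h]
  exact (Representation.Coinvariants.mk_eq_iff _).2
    (Submodule.subset_span ⟨(σ.symm, PiTensorProduct.tprod K v), rfl⟩)

/-- A product of basis vectors in `Sym^r V` depends only on the multiplicities of the factors. -/
theorem symProd_eq_of_card_fiber {r : ℕ} {B : Type*} [DecidableEq B] (b : B → V)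
    (f g : Fin r → B)
    (h : ∀ k, Fintype.card {i // f i = k} = Fintype.card {i // g i = k}) :
    symProd K r (fun i => b (f i)) = symProd K r (fun i => b (g i)) := by
  let e : ∀ k, {i // f i = k} ≃ {i // g i = k} := fun k => Fintype.equivOfCardEq (h k)
  let σ : Equiv.Perm (Fin r) := Equiv.ofFiberEquiv e
  have hσ : ∀ i, g (σ i) = f i := fun i => Equiv.ofFiberEquiv_map e i
  have hf : (fun i => b (f i)) = fun i => b (g (σ i)) := by simp only [hσ]
  rw [hf]
  exact symProd_comp_perm σ fun i => b (g i)

theorem span_symProd_basis {B : Type*} (b : Module.Basis B K V) (r : ℕ) :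
    Submodule.span K (Set.range fun f : Fin r → B => symProd K r fun i => b (f i)) = ⊤ := by
  have h := PiTensorProduct.submodule_span_eq_top (R := K) (ι := Fin r) (M := fun _ => V)
    (γ := fun _ => B) (g := fun _ => b) (fun _ => b.span_eq)
  have h2 := congrArg (Submodule.map (Representation.Coinvariants.mk (placePerm K V r))) h
  rw [Submodule.map_span, Submodule.map_top,
    LinearMap.range_eq_top.2 (Representation.Coinvariants.mk_surjective _), ← Set.range_comp] at h2
  exact h2

theorem span_rowTensor_basis {B : Type*} (b : Module.Basis B K V) (μ : YoungDiagram) :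
    Submodule.span K (Set.range fun t : μ.cells → B => rowTensor K μ fun c => b (t c)) = ⊤ := by
  have h := PiTensorProduct.submodule_span_eq_top (R := K) (ι := Fin (μ.colLen 0))
    (M := fun i => SymUpper K V (μ.rowLen i)) (γ := fun i => Fin (μ.rowLen i) → B)
    (g := fun i f => symProd K (μ.rowLen i) fun j => b (f j))
    (fun i => span_symProd_basis b (μ.rowLen i))
  rw [eq_top_iff, ← h]
  refine Submodule.span_mono ?_
  rintro _ ⟨f, rfl⟩
  refine ⟨fun c => f ⟨c.1.1, ?_⟩ ⟨c.1.2, YoungDiagram.mem_iff_lt_rowLen.1 c.2⟩, rfl⟩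
  exact YoungDiagram.mem_iff_lt_colLen.1 (μ.up_left_mem le_rfl (Nat.zero_le _) c.2)

/-- The linear map `Sym^r V → A` sending `v₁ ⋯ vᵣ` to `f v₁ ⋯ f vᵣ`. -/
def symEval (f : V →ₗ[K] A) (r : ℕ) : SymUpper K V r →ₗ[K] A :=
  Representation.Coinvariants.lift _
    (PiTensorProduct.lift ((MultilinearMap.mkPiAlgebra K (Fin r) A).compLinearMap fun _ => f)) (by
      intro σ
      refine PiTensorProduct.ext (MultilinearMap.ext fun v => ?_)
      simp only [LinearMap.compMultilinearMap_apply, LinearMap.comp_apply]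
      rw [placePerm_tprod]
      simp only [PiTensorProduct.lift.tprod, MultilinearMap.compLinearMap_apply,
        MultilinearMap.mkPiAlgebra_apply]
      exact Equiv.prod_comp σ.symm fun i => f (v i))

theorem symEval_symProd (f : V →ₗ[K] A) (r : ℕ) (v : Fin r → V) :
    symEval f r (symProd K r v) = ∏ i, f (v i) := by
  change PiTensorProduct.lift _ (PiTensorProduct.tprod K v) = _
  simp

/-- Row-wise evaluation: the linear map `Sym^μ V → A` that multiplies the images of all the
entries of a tableau, the entries of row `i` being mapped to `A` by `L i`. -/
def rowEval (L : ℕ → V →ₗ[K] A) (μ : YoungDiagram) : SymPartition K V μ →ₗ[K] A :=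
  PiTensorProduct.lift ((MultilinearMap.mkPiAlgebra K (Fin (μ.colLen 0)) A).compLinearMap
    fun i => symEval (L i) (μ.rowLen i))

/-- The boxes of `μ`, listed row by row. -/
def boxEquiv (μ : YoungDiagram) : (Σ i : Fin (μ.colLen 0), Fin (μ.rowLen i)) ≃ μ.cells where
  toFun p := box μ p.1 p.2
  invFun c := ⟨⟨c.1.1, YoungDiagram.mem_iff_lt_colLen.1
    (μ.up_left_mem le_rfl (Nat.zero_le _) c.2)⟩, ⟨c.1.2, YoungDiagram.mem_iff_lt_rowLen.1 c.2⟩⟩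
  left_inv _ := rfl
  right_inv _ := rfl

theorem rowEval_rowTensor (L : ℕ → V →ₗ[K] A) (μ : YoungDiagram) (t : μ.cells → V) :
    rowEval L μ (rowTensor K μ t) = ∏ c : μ.cells, L c.1.1 (t c) := by
  rw [rowEval, rowTensor, PiTensorProduct.lift.tprod]
  simp only [MultilinearMap.compLinearMap_apply, MultilinearMap.mkPiAlgebra_apply,
    symEval_symProd]
  rw [← Equiv.prod_comp (boxEquiv μ), Fintype.prod_sigma]
  rfl

/-- Row-wise evaluation turns polytabloids into products of minors. -/
theorem rowEval_polytabloid (L : ℕ → V →ₗ[K] A) (μ : YoungDiagram) (s : ℕ)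
    (hs : μ.rowLen 0 ≤ s) (t : ℕ → ℕ → V) :
    rowEval L μ (polytabloid K μ fun c => t c.1.1 c.1.2) =
      ∏ j ∈ Finset.range s,
        (Matrix.of fun i i' : Fin (μ.colLen j) => L i (t i' j)).det := by
  -- A matrix on all the boxes, block diagonal by columns. In its Leibniz expansion only the
  -- column-preserving permutations survive, and these give the terms of the polytabloid.
  let N : Matrix μ.cells μ.cells A :=
    Matrix.of fun c c' => if c.1.2 = c'.1.2 then L c.1.1 (t c'.1.1 c'.1.2) else 0
  have h1 : rowEval L μ (polytabloid K μ fun c => t c.1.1 c.1.2) = N.det := by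
    rw [polytabloid, map_sum, Matrix.det_apply]
    refine Finset.sum_subset_zero_on_sdiff (Finset.subset_univ _) ?_ ?_
    · intro σ hσ
      obtain ⟨c, hc⟩ : ∃ c, (σ c).1.2 ≠ c.1.2 := by
        simpa [columnPerms] using hσ
      rw [Finset.prod_eq_zero (Finset.mem_univ c), smul_zero]
      simp [N, hc]
    · intro σ hσ
      have hσ' : ∀ c, (σ c).1.2 = c.1.2 := by simpa [columnPerms] using hσ
      rw [Units.smul_def, map_zsmul, rowEval_rowTensor, Units.smul_def]
      congr 1
      rw [← Equiv.prod_comp σ]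
      refine Finset.prod_congr rfl fun c _ => ?_
      simp [N, hσ']
  have h2 : N.BlockTriangular fun c => c.1.2 := by
    intro c c' h
    have : c.1.2 ≠ c'.1.2 := ne_of_gt h
    simp [N, this]
  rw [h1, h2.det]
  have h3 : (Finset.univ.image fun c : μ.cells => c.1.2) ⊆ Finset.range s := by
    intro j hj
    obtain ⟨c, -, rfl⟩ := Finset.mem_image.1 hj
    have := YoungDiagram.mem_iff_lt_rowLen.1 (μ.up_left_mem (Nat.zero_le _) le_rfl c.2)
    exact Finset.mem_range.2 (this.trans_le hs)
  -- Columns `j < s` without boxes contribute the empty determinant 1.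
  refine (Finset.prod_subset h3 fun j _ hj => ?_).trans (Finset.prod_congr rfl fun j _ => ?_)
  · have : IsEmpty {c : μ.cells // c.1.2 = j} :=
      ⟨fun c => hj (Finset.mem_image.2 ⟨c.1, Finset.mem_univ _, c.2⟩)⟩
    exact Matrix.det_isEmpty
  · let e : Fin (μ.colLen j) ≃ {c : μ.cells // c.1.2 = j} :=
      { toFun := fun i => ⟨⟨(i, j), YoungDiagram.mem_iff_lt_colLen.2 i.2⟩, rfl⟩
        invFun := fun c => ⟨c.1.1.1, (YoungDiagram.mem_iff_lt_colLen.1 c.1.2).trans_eq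
          (congrArg μ.colLen c.2)⟩
        left_inv := fun _ => rfl
        right_inv := by
          rintro ⟨⟨⟨i, j'⟩, hc⟩, rfl⟩
          rfl }
    rw [← Matrix.det_submatrix_equiv_self e]
    congr 1
    ext i i'
    simp [N, e, Matrix.toSquareBlock_def]

end SymmetricPower

/-! ### Injectivity of generic evaluation; bases of symmetric powers -/

section Injectivity

variable {K : Type*} [Field K] {V : Type*} [AddCommGroup V] [Module K V]

/-- A linear map is injective if it sends a spanning family to members of a linearly independent
family, and distinct members of the spanning family to distinct members of the latter. -/
theorem injective_of_span_of_linearIndependent {W ι κ : Type*} [AddCommGroup W] [Module K W]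
    (f : V →ₗ[K] W) (v : ι → V) (hv : Submodule.span K (Set.range v) = ⊤) (m : ι → κ) (u : κ → W)
    (hu : LinearIndependent K u) (hf : ∀ i, f (v i) = u (m i))
    (hm : ∀ i j, m i = m j → v i = v j) : Function.Injective f := by
  choose p hp using fun n : Set.range m => n.2
  have hspan : Submodule.span K (Set.range (v ∘ p)) = ⊤ := by
    rw [eq_top_iff, ← hv]
    refine Submodule.span_mono ?_
    rintro _ ⟨i, rfl⟩
    exact ⟨⟨m i, i, rfl⟩, hm _ _ (hp _)⟩
  have hind : LinearIndependent K (f ∘ v ∘ p) := by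
    have : f ∘ v ∘ p = u ∘ Subtype.val := by
      funext n
      simp [hf, hp]
    rw [this]
    exact hu.comp _ Subtype.val_injective
  rw [injective_iff_map_eq_zero]
  intro x hx
  obtain ⟨c, rfl⟩ := (Finsupp.mem_span_range_iff_exists_finsupp (R := K)).1
    (hspan ▸ Submodule.mem_top : x ∈ Submodule.span K (Set.range (v ∘ p)))
  have : c = 0 := by
    refine (linearIndependent_iff.1 hind) c ?_
    rw [← hx, map_finsuppSum]
    simp [Finsupp.linearCombination_apply]
  simp [this]

/-- Row-wise evaluation at the rows of a generic matrix is injective on `Sym^μ V`. -/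
theorem rowEval_injective {B : Type*} (b : Module.Basis B K V) {d : ℕ} (μ : YoungDiagram)
    (hμ : μ.colLen 0 ≤ d) (L : ℕ → V →ₗ[K] MvPolynomial (Fin d × B) K)
    (hL : ∀ (i : Fin d) (k : B), L i (b k) = MvPolynomial.X (i, k)) :
    Function.Injective (rowEval L μ) := by
  classical
  let row (c : μ.cells) : Fin d := ⟨c.1.1, (YoungDiagram.mem_iff_lt_colLen.1
    (μ.up_left_mem le_rfl (Nat.zero_le _) c.2)).trans_le hμ⟩
  -- The exponent of the variable `(i, k)` counts the entries `k` in row `i`. These multiplicities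
  -- are the exponents of the image monomial, and they determine the row tensor.
  let m (t : μ.cells → B) : (Fin d × B) →₀ ℕ := ∑ c, Finsupp.single (row c, t c) 1
  refine injective_of_span_of_linearIndependent (rowEval L μ) _ (span_rowTensor_basis b μ) m
    (MvPolynomial.basisMonomials (Fin d × B) K) (MvPolynomial.basisMonomials _ K).linearIndependent
    (fun t => ?_) (fun t t' h => ?_)
  · rw [rowEval_rowTensor, MvPolynomial.coe_basisMonomials]
    have : ∀ c, L c.1.1 (b (t c)) = MvPolynomial.monomial (Finsupp.single (row c, t c) 1) 1 :=
      fun c => hL (row c) (t c)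
    simp only [this, m, MvPolynomial.monomial_sum_one]
  · unfold rowTensor
    congr 1
    funext i
    refine symProd_eq_of_card_fiber b _ _ fun k => ?_
    have key (t : μ.cells → B) : m t (⟨i, i.2.trans_le hμ⟩, k) =
        Fintype.card {j : Fin (μ.rowLen i) // t (box μ i j) = k} := by
      simp only [m, Finsupp.coe_finsetSum, Finset.sum_apply]
      rw [← Equiv.sum_comp (boxEquiv μ), Fintype.sum_sigma, Fintype.sum_eq_single i]
      · rw [Fintype.card_subtype]
        simp only [boxEquiv, Equiv.coe_fn_mk, row, box, Finsupp.single_apply, Prod.mk.injEq,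
          true_and, Finset.sum_boole, Nat.cast_id]
        congr!
      · intro i' hi'
        refine Finset.sum_eq_zero fun j _ => ?_
        have : (i' : ℕ) ≠ i := fun h => hi' (Fin.ext h)
        simp [boxEquiv, row, box, this]
    rw [← key, ← key, h]

/-- The products `e₀ ^ k e₁ ^ (r - k)` form a basis of `Sym^r V` if `e₀, e₁` is a basis of `V`. -/
theorem nonempty_basis_symUpper (b : Module.Basis (Fin 2) K V) (r : ℕ) :
    Nonempty (Module.Basis (Fin (r + 1)) K (SymUpper K V r)) := by
  let w (k : Fin (r + 1)) : Fin r → Fin 2 := fun j => if (j : ℕ) < k then 0 else 1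
  let v (k : Fin (r + 1)) : SymUpper K V r := symProd K r fun j => b (w k j)
  -- Dehomogenizing sends the candidate basis vectors to distinct powers of `X`, so they are
  -- independent.
  let ev : V →ₗ[K] Polynomial K := b.constr K ![Polynomial.X, 1]
  have hcard (k : Fin (r + 1)) : Fintype.card {j // w k j = 0} = k := by
    have : ∀ j, w k j = 0 ↔ (j : ℕ) < k := by
      intro j
      by_cases h : (j : ℕ) < k <;> simp [w, h]
    simp only [this, Fintype.card_subtype]
    have := Fin.card_filter_val_lt (n := r) (m := k)
    omega
  have hev (f : Fin r → Fin 2) : symEval ev r (symProd K r fun j => b (f j)) =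
      Polynomial.X ^ Fintype.card {j // f j = 0} := by
    rw [symEval_symProd]
    have : ∀ k : Fin 2, ev (b k) = if k = 0 then Polynomial.X else 1 := by
      intro k
      fin_cases k <;> simp [ev]
    simp only [this, Finset.prod_ite, Finset.prod_const, one_pow, mul_one,
      Fintype.card_subtype]
  have hv : LinearIndependent K v := by
    refine LinearIndependent.of_comp (symEval ev r) ?_
    have : symEval ev r ∘ v = (Polynomial.basisMonomials K) ∘ Fin.val := by
      funext k
      simp only [Function.comp_apply, v, hev, hcard, Polynomial.coe_basisMonomials,
        Polynomial.X_pow_eq_monomial]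
    rw [this]
    exact (Polynomial.basisMonomials K).linearIndependent.comp _ Fin.val_injective
  refine ⟨Module.Basis.mk hv ?_⟩
  rw [← span_symProd_basis b r]
  refine Submodule.span_mono ?_
  rintro _ ⟨f, rfl⟩
  have hle : Fintype.card {j // f j = 0} ≤ r := by
    simpa using Fintype.card_subtype_le fun j => f j = 0
  refine ⟨⟨Fintype.card {j // f j = 0}, Nat.lt_succ_of_le hle⟩, ?_⟩
  refine symProd_eq_of_card_fiber b _ _ fun k => ?_
  have h0 : ∀ g : Fin r → Fin 2, Fintype.card {j // g j = 1} = r - Fintype.card {j // g j = 0} := by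
    intro g
    have h1 : ∀ j, g j = 1 ↔ ¬ g j = 0 := fun j => by
      generalize g j = a
      fin_cases a <;> simp
    simp only [h1, Fintype.card_subtype_compl, Fintype.card_fin]
  have hk : k = 0 ∨ k = 1 := by fin_cases k <;> simp
  rcases hk with rfl | rfl
  · exact hcard _
  · rw [h0, h0, hcard]

end Injectivity

/-! ### Complementary minors and complementary diagrams -/

section Minors

variable {A : Type*} [CommRing A] {d : ℕ}

/-- The inverse transpose of a matrix, with the order of its rows reversed. -/
def rotInv (M : Matrix (Fin d) (Fin d) A) : Matrix (Fin d) (Fin d) A :=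
  Matrix.of fun i k => M⁻¹ k (Fin.rev i)

theorem rotInv_eq_submatrix (M : Matrix (Fin d) (Fin d) A) :
    rotInv M = (M.transpose)⁻¹.submatrix Fin.revPerm (Equiv.refl _) := by
  rw [← Matrix.transpose_nonsing_inv]
  rfl

theorem isUnit_det_rotInv {M : Matrix (Fin d) (Fin d) A} (hM : IsUnit M.det) :
    IsUnit (rotInv M).det := by
  have h : IsUnit (rotInv M) := by
    rw [rotInv_eq_submatrix, Matrix.isUnit_submatrix_equiv, Matrix.isUnit_nonsing_inv_iff,
      Matrix.isUnit_transpose]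
    exact (Matrix.isUnit_iff_isUnit_det M).2 hM
  exact (Matrix.isUnit_iff_isUnit_det _).1 h

/-- With J the row-reversal matrix, `rotInv M` is J times the inverse transpose of M. Since J is its
own inverse transpose, applying `rotInv` twice gives JJM = M. -/
theorem rotInv_rotInv {M : Matrix (Fin d) (Fin d) A} (hM : IsUnit M.det) :
    rotInv (rotInv M) = M := by
  ext i k
  rw [rotInv, rotInv_eq_submatrix M, Matrix.inv_submatrix_equiv,
    Matrix.nonsing_inv_nonsing_inv _ (by rwa [Matrix.det_transpose])]
  simp

theorem rotInv_mul (M P : Matrix (Fin d) (Fin d) A) :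
    rotInv (M * P) = rotInv M * P⁻¹.transpose := by
  ext i k
  simp only [rotInv, Matrix.mul_inv_rev, Matrix.of_apply, Matrix.mul_apply, Matrix.transpose_apply]
  exact Finset.sum_congr rfl fun j _ => mul_comm _ _

theorem map_rotInv {A' : Type*} [CommRing A'] (φ : A →+* A') {M : Matrix (Fin d) (Fin d) A}
    (hM : IsUnit M.det) : (rotInv M).map φ = rotInv (M.map φ) := by
  have h : M.map φ * M⁻¹.map φ = 1 := by
    rw [← Matrix.map_mul, Matrix.mul_nonsing_inv _ hM, Matrix.map_one _ (map_zero φ) (map_one φ)]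
  ext i k
  simp [rotInv, Matrix.inv_eq_right_inv h]

/-- The rows of a matrix, followed by zero rows. -/
def rowExt (M : Matrix (Fin d) (Fin d) A) (i : ℕ) (k : Fin d) : A :=
  if h : i < d then M ⟨i, h⟩ k else 0

theorem rowExt_of_lt (M : Matrix (Fin d) (Fin d) A) {i : ℕ} (h : i < d) (k : Fin d) :
    rowExt M i k = M ⟨i, h⟩ k := dif_pos h

/-- The minor of `M` on the first `a` rows and the columns `f 0, …, f (a - 1)`. -/
def topMinor (M : Matrix (Fin d) (Fin d) A) (a : ℕ) (f : ℕ → Fin d) : A :=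
  (Matrix.of fun i i' : Fin a => rowExt M i (f i')).det

/-- Jacobi's theorem on complementary minors of the inverse matrix. -/
theorem exists_topMinor_eq {M : Matrix (Fin d) (Fin d) A} (hM : IsUnit M.det) {a : ℕ}
    (ha : a ≤ d) (f : ℕ → Fin d) :
    ∃ (c : ℤ) (f' : ℕ → Fin d),
      topMinor M a f = c * (M.det * topMinor (rotInv M) (d - a) f') := by
  classical
  -- A repeated column makes the minor vanish, which is why the coefficient `c` is allowed to be 0
  -- and not only a sign.
  by_cases hf : Function.Injective fun i : Fin a => f i
  swap
  · refine ⟨0, f, ?_⟩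
    simp only [Function.Injective, not_forall] at hf
    obtain ⟨i, j, hij, hne⟩ := hf
    rw [Int.cast_zero, zero_mul, topMinor]
    refine Matrix.det_zero_of_column_eq hne fun k => ?_
    simp only [Matrix.of_apply]
    exact congrArg _ hij
  obtain ⟨e, he⟩ : ∃ e : Fin a ⊕ Fin (d - a) ≃ Fin d, ∀ i, e (Sum.inl i) = f i := by
    let F : Set (Fin d) := Set.range fun i : Fin a => f i
    have hcard : Fintype.card (Fin (d - a)) = Fintype.card (Fᶜ : Set (Fin d)) := by
      rw [Fintype.card_compl_set, Set.card_range_of_injective hf]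
      simp
    refine ⟨((Equiv.ofInjective _ hf).sumCongr (Fintype.equivOfCardEq hcard)).trans
      (Equiv.Set.sumCompl F), fun i => ?_⟩
    simp
  -- The top `a` rows in order, then the other rows from the bottom up. This order matches the first
  -- `d - a` rows of `rotInv M`.
  let r : Fin a ⊕ Fin (d - a) ≃ Fin d :=
    ((Equiv.refl _).sumCongr Fin.revPerm).trans
      (finSumFinEquiv.trans (finCongr (Nat.add_sub_cancel' ha)))
  have hr1 : ∀ i, ((r (Sum.inl i) : Fin d) : ℕ) = i := fun i => by simp [r]
  have hr2 : ∀ i, r (Sum.inr i) = Fin.rev ⟨i, i.2.trans_le (Nat.sub_le _ _)⟩ := fun i => by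
    ext
    simp only [r, Equiv.trans_apply, Equiv.sumCongr_apply, Sum.map_inr, finSumFinEquiv_apply_right,
      finCongr_apply, Fin.val_cast, Fin.val_natAdd, Fin.revPerm_apply, Fin.val_rev]
    omega
  let X := M.submatrix r e
  let Y := M⁻¹.submatrix e r
  have hXY : X * Y = 1 := by
    simp only [X, Y]
    rw [Matrix.submatrix_mul_equiv, Matrix.mul_nonsing_inv _ hM, Matrix.submatrix_one_equiv]
  rw [← Matrix.fromBlocks_toBlocks X, ← Matrix.fromBlocks_toBlocks Y, Matrix.fromBlocks_multiply,
    ← Matrix.fromBlocks_one, Matrix.fromBlocks_inj] at hXY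
  obtain ⟨-, h12, -, h22⟩ := hXY
  -- Since XY = 1, multiplying X by [1, Y₁₂; 0, Y₂₂] gives [X₁₁, 0; X₂₁, 1]. Determinants yield det
  -- X · det Y₂₂ = det X₁₁.
  have hdet := congrArg Matrix.det (Matrix.fromBlocks_multiply X.toBlocks₁₁ X.toBlocks₁₂
    X.toBlocks₂₁ X.toBlocks₂₂ 1 Y.toBlocks₁₂ 0 Y.toBlocks₂₂)
  rw [h12, h22, Matrix.fromBlocks_toBlocks, Matrix.det_mul, Matrix.det_fromBlocks_zero₂₁,
    Matrix.mul_zero, add_zero, Matrix.mul_one, Matrix.det_fromBlocks_zero₁₂, Matrix.det_one,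
    Matrix.det_one, one_mul, mul_one] at hdet
  have hX : X.det = Equiv.Perm.sign (r.symm.trans e) * M.det := by
    rw [← Matrix.det_permute', ← Matrix.det_submatrix_equiv_self r]
    congr 1
    ext i j
    simp [X]
  -- The value `f 0` is a filler: the minor of size `d - a` never reads it.
  refine ⟨Equiv.Perm.sign (r.symm.trans e),
    fun n => if h : n < d - a then e (Sum.inr ⟨n, h⟩) else f 0, ?_⟩
  have hY : Y.toBlocks₂₂.det = topMinor (rotInv M) (d - a)
      (fun n => if h : n < d - a then e (Sum.inr ⟨n, h⟩) else f 0) := by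
    rw [topMinor, ← Matrix.det_transpose]
    congr 1
    ext i j
    have hi : (i : ℕ) < d := i.2.trans_le (Nat.sub_le _ _)
    simp [Y, Matrix.toBlocks₂₂, rowExt_of_lt _ hi, hr2, rotInv]
  have hA : X.toBlocks₁₁.det = topMinor M a f := by
    rw [topMinor]
    congr 1
    ext i j
    have hi : (i : ℕ) < d := i.2.trans_le ha
    have : r (Sum.inl i) = ⟨i, hi⟩ := Fin.ext (hr1 i)
    simp [X, Matrix.toBlocks₁₁, rowExt_of_lt _ hi, he, this]
  rw [← hA, ← hdet, hX, hY, mul_assoc]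

/-- The span of the products over `j < s` of minors of `M` on the first `a j` rows. -/
def minorSpan (K : Type*) [Field K] [Algebra K A] (M : Matrix (Fin d) (Fin d) A) (s : ℕ)
    (a : ℕ → ℕ) : Submodule K A :=
  Submodule.span K (Set.range fun t : ℕ → ℕ → Fin d =>
    ∏ j ∈ Finset.range s, topMinor M (a j) fun i => t i j)

/-- Jacobi's theorem is applied to each of the `s` factors. The half-turn in the complement pairs
column `j` with column `s - 1 - j`. -/
theorem minorSpan_le (K : Type*) [Field K] [Algebra K A] {M : Matrix (Fin d) (Fin d) A}
    (hM : IsUnit M.det) (s : ℕ) (a a' : ℕ → ℕ) (ha : ∀ j < s, a j ≤ d)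
    (ha' : ∀ j < s, a' j = d - a (s - 1 - j)) :
    minorSpan K M s a ≤
      (minorSpan K (rotInv M) s a').map (LinearMap.mulLeft K (M.det ^ s)) := by
  refine Submodule.span_le.2 ?_
  rintro _ ⟨t, rfl⟩
  have h (j : ℕ) : ∃ (c : ℤ) (f' : ℕ → Fin d), j < s → topMinor M (a j) (fun i => t i j) =
      c * (M.det * topMinor (rotInv M) (d - a j) f') := by
    by_cases hj : j < s
    · obtain ⟨c, f', h⟩ := exists_topMinor_eq hM (ha j hj) fun i => t i j
      exact ⟨c, f', fun _ => h⟩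
    · exact ⟨0, fun i => t i j, fun h => absurd h hj⟩
  choose c t' h using h
  have hmem : (∏ j ∈ Finset.range s, topMinor (rotInv M) (a' j) fun i => t' (s - 1 - j) i) ∈
      minorSpan K (rotInv M) s a' := Submodule.subset_span ⟨fun i j => t' (s - 1 - j) i, rfl⟩
  refine ⟨((∏ j ∈ Finset.range s, c j : ℤ) : A) * ∏ j ∈ Finset.range s,
    topMinor (rotInv M) (a' j) fun i => t' (s - 1 - j) i, ?_, ?_⟩
  · rw [← zsmul_eq_mul]
    exact zsmul_mem hmem _
  · have h1 : ∏ j ∈ Finset.range s, topMinor (rotInv M) (a' j) (fun i => t' (s - 1 - j) i) =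
        ∏ j ∈ Finset.range s, topMinor (rotInv M) (d - a j) (t' j) := by
      rw [← Finset.prod_range_reflect]
      refine Finset.prod_congr rfl fun j hj => ?_
      have hj' := Finset.mem_range.1 hj
      have h2 : s - 1 - (s - 1 - j) = j := by omega
      rw [ha' _ (by omega), h2]
    simp only [LinearMap.mulLeft_apply]
    rw [h1, Finset.prod_congr rfl fun j hj => h j (Finset.mem_range.1 hj),
      Finset.prod_mul_distrib, Finset.prod_mul_distrib, Finset.prod_const, Finset.card_range,
      Int.cast_prod]
    ring

theorem det_mul_det_rotInv {M : Matrix (Fin d) (Fin d) A} (hM : IsUnit M.det) :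
    ∃ ε : ℤˣ, M.det * (rotInv M).det = ((ε : ℤ) : A) := by
  refine ⟨Equiv.Perm.sign (Fin.revPerm : Equiv.Perm (Fin d)), ?_⟩
  have : (rotInv M).det =
      ((Equiv.Perm.sign (Fin.revPerm : Equiv.Perm (Fin d)) : ℤ) : A) * M.transpose⁻¹.det := by
    rw [rotInv_eq_submatrix]
    exact Matrix.det_permute _ _
  rw [this, mul_left_comm, ← Matrix.det_transpose M, ← Matrix.det_mul, Matrix.mul_nonsing_inv _
    (by rwa [Matrix.det_transpose]), Matrix.det_one, mul_one]

/-- As `rotInv` is an involution, the reverse inclusion is `minorSpan_le` for `rotInv M`. The two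
scalings combine to a power of ±1, under which the span is stable. -/
theorem minorSpan_eq (K : Type*) [Field K] [Algebra K A] {M : Matrix (Fin d) (Fin d) A}
    (hM : IsUnit M.det) (s : ℕ) (a a' : ℕ → ℕ) (ha : ∀ j < s, a j ≤ d)
    (ha' : ∀ j < s, a' j = d - a (s - 1 - j)) :
    minorSpan K M s a =
      (minorSpan K (rotInv M) s a').map (LinearMap.mulLeft K (M.det ^ s)) := by
  refine le_antisymm (minorSpan_le K hM s a a' ha ha') ?_
  have h := minorSpan_le K (isUnit_det_rotInv hM) s a' a
    (fun j hj => by rw [ha' j hj]; exact Nat.sub_le _ _) (fun j hj => by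
      have h1 := ha j hj
      have h2 : s - 1 - (s - 1 - j) = j := by omega
      rw [ha' _ (by omega), h2]
      omega)
  rw [rotInv_rotInv hM] at h
  refine (Submodule.map_mono h).trans ?_
  rw [← Submodule.map_comp]
  rintro _ ⟨x, hx, rfl⟩
  obtain ⟨ε, hε⟩ := det_mul_det_rotInv hM
  simp only [LinearMap.comp_apply, LinearMap.mulLeft_apply]
  rw [← mul_assoc, ← mul_pow, hε, ← Int.cast_pow, ← zsmul_eq_mul]
  exact zsmul_mem hx _

theorem colLen_complement (μ : YoungDiagram) (d s j : ℕ) (hj : j < s) :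
    (complement μ d s).colLen j = d - μ.colLen (s - 1 - j) := by
  refine eq_of_forall_lt_iff fun i => ?_
  rw [← YoungDiagram.mem_iff_lt_colLen, ← YoungDiagram.mem_cells]
  simp only [complement, Finset.mem_filter, Finset.mem_product, Finset.mem_range,
    YoungDiagram.mem_iff_lt_colLen]
  omega

theorem colLen_complement_le (μ : YoungDiagram) (d s j : ℕ) : (complement μ d s).colLen j ≤ d := by
  refine le_of_forall_lt fun i hi => ?_
  rw [← YoungDiagram.mem_iff_lt_colLen, ← YoungDiagram.mem_cells] at hi
  simp only [complement, Finset.mem_filter, Finset.mem_product, Finset.mem_range] at hi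
  exact hi.1.1

theorem rowLen_complement_le (μ : YoungDiagram) (d s i : ℕ) : (complement μ d s).rowLen i ≤ s := by
  refine le_of_forall_lt fun j hj => ?_
  rw [← YoungDiagram.mem_iff_lt_rowLen, ← YoungDiagram.mem_cells] at hj
  simp only [complement, Finset.mem_filter, Finset.mem_product, Finset.mem_range] at hj
  exact hj.1.2

end Minors

/-! ### The generic invertible matrix -/

section GenericMatrix

/-- A generic invertible matrix: an invertible matrix `X` over a `K`-algebra `A` whose entries are
algebraically independent, as are those of `rotInv X`, and which specializes to every
invertible matrix over `A`. -/
theorem exists_generic_matrix.{u} (K : Type u) [Field K] (d : ℕ) :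
    ∃ (A : Type u) (_ : CommRing A) (_ : Algebra K A) (X : Matrix (Fin d) (Fin d) A),
      IsUnit X.det ∧
      Function.Injective (MvPolynomial.aeval (R := K) fun p : Fin d × Fin d => X p.1 p.2) ∧
      Function.Injective (MvPolynomial.aeval (R := K) fun p : Fin d × Fin d => rotInv X p.1 p.2) ∧
      ∀ Y : Matrix (Fin d) (Fin d) A, IsUnit Y.det → ∃ α : A →ₐ[K] A, X.map α = Y := by
  let R := MvPolynomial (Fin d × Fin d) K
  let D : R := (Matrix.mvPolynomialX (Fin d) (Fin d) K).det
  let A := Localization.Away D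
  let X : Matrix (Fin d) (Fin d) A :=
    (Matrix.mvPolynomialX (Fin d) (Fin d) K).map (algebraMap R A)
  have hX : IsUnit X.det := by
    have : X.det = algebraMap R A D := by
      rw [RingHom.map_det]
      rfl
    rw [this]
    exact IsLocalization.Away.algebraMap_isUnit D
  have haev : MvPolynomial.aeval (R := K) (fun p : Fin d × Fin d => X p.1 p.2) =
      IsScalarTower.toAlgHom K R A := by
    refine MvPolynomial.algHom_ext fun p => ?_
    rw [MvPolynomial.aeval_X]
    rfl
  have hinj : Function.Injective
      (MvPolynomial.aeval (R := K) fun p : Fin d × Fin d => X p.1 p.2) := by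
    rw [haev]
    exact IsLocalization.injective A
      (powers_le_nonZeroDivisors_of_noZeroDivisors (Matrix.det_mvPolynomialX_ne_zero (Fin d) K))
  have hlift (Y : Matrix (Fin d) (Fin d) A) (hY : IsUnit Y.det) :
      ∃ α : A →ₐ[K] A, X.map α = Y := by
    let φ : R →ₐ[K] A := MvPolynomial.aeval fun p : Fin d × Fin d => Y p.1 p.2
    have hφ : IsUnit (φ D) := by
      have : φ D = Y.det := by
        rw [AlgHom.map_det, Matrix.mvPolynomialX_mapMatrix_aeval]
      rwa [this]
    refine ⟨IsLocalization.Away.liftAlgHom D hφ, ?_⟩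
    ext i k
    simp only [Matrix.map_apply, X, IsLocalization.Away.coe_liftAlgHom]
    exact (IsLocalization.Away.lift_eq D hφ _).trans (MvPolynomial.aeval_X _ _)
  refine ⟨A, inferInstance, inferInstance, X, hX, hinj, ?_, hlift⟩
  -- The specialization of `X` to `rotInv X` carries `rotInv X` back to `X`, so a relation among the
  -- entries of `rotInv X` would give one among those of `X`.
  obtain ⟨ψ, hψ⟩ := hlift (rotInv X) (isUnit_det_rotInv hX)
  have hψ2 : ∀ i k, ψ (rotInv X i k) = X i k := by
    intro i k
    have h1 := map_rotInv (ψ : A →+* A) hX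
    have h2 : X.map (ψ : A →+* A) = rotInv X := hψ
    rw [h2, rotInv_rotInv hX] at h1
    exact congrFun (congrFun h1 i) k
  have hcomp : ψ.comp (MvPolynomial.aeval (R := K) fun p : Fin d × Fin d => rotInv X p.1 p.2) =
      MvPolynomial.aeval (R := K) fun p : Fin d × Fin d => X p.1 p.2 := by
    refine MvPolynomial.algHom_ext fun p => ?_
    simp [hψ2]
  refine Function.Injective.of_comp (f := ψ) ?_
  rw [← AlgHom.coe_comp, hcomp]
  exact hinj

end GenericMatrix

/-! ### Schur functors as spans of products of minors -/

section Evaluation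

variable {K : Type*} [Field K] {V : Type*} [AddCommGroup V] [Module K V]
  {A : Type*} [CommRing A] [Algebra K A] {d : ℕ}

theorem symPartition_hom_ext {W : Type*} [AddCommGroup W] [Module K W] {μ : YoungDiagram}
    {f g : SymPartition K V μ →ₗ[K] W}
    (h : ∀ t, f (rowTensor K μ t) = g (rowTensor K μ t)) : f = g := by
  refine LinearMap.ext_on_range (span_rowTensor_basis (Module.Basis.ofVectorSpace K V) μ)
    fun t => h _

theorem map_rowEval {A' : Type*} [CommRing A'] [Algebra K A'] (φ : A →ₐ[K] A')
    (L : ℕ → V →ₗ[K] A) (L' : ℕ → V →ₗ[K] A') (h : ∀ i v, φ (L i v) = L' i v) (μ : YoungDiagram)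
    (x : SymPartition K V μ) : φ (rowEval L μ x) = rowEval L' μ x := by
  have : φ.toLinearMap ∘ₗ rowEval L μ = rowEval L' μ := by
    refine symPartition_hom_ext fun t => ?_
    simp [rowEval_rowTensor, h]
  exact LinearMap.congr_fun this x

theorem rowEval_symPartitionRep {G : Type*} [Group G] (ρ : Representation K G V) (g : G)
    (L L' : ℕ → V →ₗ[K] A) (h : ∀ i v, L' i v = L i (ρ g v)) (μ : YoungDiagram)
    (x : SymPartition K V μ) : rowEval L μ (symPartitionRep ρ μ g x) = rowEval L' μ x := by
  have : rowEval L μ ∘ₗ symPartitionRep ρ μ g = rowEval L' μ := by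
    refine symPartition_hom_ext fun t => ?_
    have ht : symPartitionRep ρ μ g (rowTensor K μ t) = rowTensor K μ (fun c => ρ g (t c)) := by
      refine (PiTensorProduct.map_tprod _ _).trans ?_
      simp only [symUpperRep_symProd]
      rfl
    simp [ht, rowEval_rowTensor, h]
  exact LinearMap.congr_fun this x

/-- The linear forms on `V` given by the rows of a matrix in the coordinates of a basis. -/
def rowForms (b : Module.Basis (Fin d) K V) (M : Matrix (Fin d) (Fin d) A) (i : ℕ) : V →ₗ[K] A :=
  b.constr K (rowExt M i)

theorem rowForms_basis (b : Module.Basis (Fin d) K V) (M : Matrix (Fin d) (Fin d) A) (i : ℕ)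
    (k : Fin d) : rowForms b M i (b k) = rowExt M i k :=
  b.constr_basis K _ _

/-- The evaluation factors as the one at a matrix of indeterminates, injective by
`rowEval_injective`, followed by the substitution of the entries of `M`. -/
theorem rowEval_rowForms_injective (b : Module.Basis (Fin d) K V) (M : Matrix (Fin d) (Fin d) A)
    (hM : Function.Injective (MvPolynomial.aeval (R := K) fun p : Fin d × Fin d => M p.1 p.2))
    (μ : YoungDiagram) (hμ : μ.colLen 0 ≤ d) :
    Function.Injective (rowEval (rowForms b M) μ) := by
  let X := Matrix.mvPolynomialX (Fin d) (Fin d) K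
  have h1 : Function.Injective (rowEval (rowForms b X) μ) := by
    refine rowEval_injective b μ hμ _ fun i k => ?_
    rw [rowForms_basis, rowExt_of_lt _ i.2]
    rfl
  have h2 (i : ℕ) (v : V) : MvPolynomial.aeval (R := K) (fun p : Fin d × Fin d => M p.1 p.2)
      (rowForms b X i v) = rowForms b M i v := by
    have : (MvPolynomial.aeval (R := K) (fun p : Fin d × Fin d => M p.1 p.2)).toLinearMap ∘ₗ
        rowForms b X i = rowForms b M i := by
      refine b.ext fun k => ?_
      simp only [LinearMap.comp_apply, AlgHom.toLinearMap_apply, rowForms_basis, rowExt]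
      split_ifs <;> simp [X]
    exact LinearMap.congr_fun this v
  have h3 : ⇑(rowEval (rowForms b M) μ) =
      MvPolynomial.aeval (R := K) (fun p : Fin d × Fin d => M p.1 p.2) ∘
        rowEval (rowForms b X) μ := by
    funext x
    exact (map_rowEval _ _ _ h2 μ x).symm
  rw [h3]
  exact hM.comp h1

/-- Precomposing the row forms of `M` with `ρ g` multiplies `M` on the right by the matrix of `ρ g`.
Thus the action of `g` is realized by a ring endomorphism. -/
theorem map_rowEval_rowForms {G : Type*} [Group G] (ρ : Representation K G V)
    (b : Module.Basis (Fin d) K V) (M : Matrix (Fin d) (Fin d) A) (g : G) (α : A →ₐ[K] A)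
    (hα : M.map α = M * (LinearMap.toMatrix b b (ρ g)).map (algebraMap K A)) (μ : YoungDiagram)
    (x : SymPartition K V μ) :
    α (rowEval (rowForms b M) μ x) = rowEval (rowForms b M) μ (symPartitionRep ρ μ g x) := by
  rw [rowEval_symPartitionRep ρ g (rowForms b M) (fun i => rowForms b M i ∘ₗ ρ g)
    fun _ _ => rfl]
  refine map_rowEval α _ _ (fun i v => ?_) μ x
  have : α.toLinearMap ∘ₗ rowForms b M i = rowForms b M i ∘ₗ ρ g := by
    refine b.ext fun k => ?_
    have hk : ρ g (b k) = ∑ m, LinearMap.toMatrix b b (ρ g) m k • b m := by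
      simp only [LinearMap.toMatrix_apply]
      exact (b.sum_repr _).symm
    simp only [LinearMap.comp_apply, AlgHom.toLinearMap_apply, hk, map_sum, map_smul,
      rowForms_basis]
    by_cases hi : i < d
    · simp only [rowExt_of_lt _ hi]
      have := congrFun (congrFun hα ⟨i, hi⟩) k
      simp only [Matrix.map_apply, Matrix.mul_apply] at this
      rw [this]
      exact Finset.sum_congr rfl fun m _ => by rw [Algebra.smul_def, mul_comm]
    · simp [rowExt, hi]
  exact LinearMap.congr_fun this v

theorem map_rowEval_schur [NeZero d] (b : Module.Basis (Fin d) K V)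
    (M : Matrix (Fin d) (Fin d) A) (μ : YoungDiagram) (s : ℕ) (hs : μ.rowLen 0 ≤ s) :
    (schur K V μ).map (rowEval (rowForms b M) μ) = minorSpan K M s μ.colLen := by
  have key (t : ℕ → ℕ → Fin d) :
      rowEval (rowForms b M) μ (polytabloid K μ fun c => b (t c.1.1 c.1.2)) =
        ∏ j ∈ Finset.range s, topMinor M (μ.colLen j) fun i => t i j := by
    rw [rowEval_polytabloid (rowForms b M) μ s hs fun i j => b (t i j)]
    simp only [rowForms_basis, topMinor]
  rw [schur_eq_span_basis K V μ b, Submodule.map_span, minorSpan]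
  refine congrArg _ (Set.Subset.antisymm ?_ ?_)
  · rintro _ ⟨_, ⟨t, rfl⟩, rfl⟩
    -- Entries outside the diagram are never read; the filler `0` exists because `d` is nonzero.
    refine ⟨fun i j => if h : (i, j) ∈ μ.cells then t ⟨(i, j), h⟩ else 0, ?_⟩
    dsimp only
    rw [← key]
    congr 2
    funext c
    rw [dif_pos c.2]
  · rintro _ ⟨t, rfl⟩
    exact ⟨_, ⟨fun c => t c.1.1 c.1.2, rfl⟩, key t⟩

end Evaluation

/-! ### The complementary partition isomorphism -/

section Complement

variable {K : Type*} [Field K] {V U : Type*} [AddCommGroup V] [Module K V]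
  [AddCommGroup U] [Module K U]

theorem exists_equiv_of_map_eq {W W' A : Type*} [AddCommGroup W] [Module K W] [AddCommGroup W']
    [Module K W'] [AddCommGroup A] [Module K A] (f : W →ₗ[K] A) (hf : Function.Injective f)
    (f' : W' →ₗ[K] A) (hf' : Function.Injective f') (S : Submodule K W) (S' : Submodule K W')
    (h : S.map f = S'.map f') : ∃ e : S ≃ₗ[K] S', ∀ x, f' (e x) = f x := by
  refine ⟨(S.equivMapOfInjective f hf).trans ((LinearEquiv.ofEq _ _ h).trans
    (S'.equivMapOfInjective f' hf').symm), fun x => ?_⟩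
  rw [← Submodule.coe_equivMapOfInjective_apply f' hf' S']
  simp

/-- The complementary partition isomorphism `∇^μ V ≅ ∇^{μ°} V^*` for a `d`-dimensional
representation `V` of determinant `1`. -/
theorem schurRep_equiv_complement {G : Type*} [Group G] {d : ℕ} [NeZero d]
    (ρ : Representation K G V) (ρ' : Representation K G U) (b : Module.Basis (Fin d) K V)
    (b' : Module.Basis (Fin d) K U)
    (hdual : ∀ g, LinearMap.toMatrix b' b' (ρ' g) = (LinearMap.toMatrix b b (ρ g))⁻¹.transpose)
    (hdet : ∀ g, LinearMap.det (ρ g) = 1) (μ : YoungDiagram) (s : ℕ) (hd : μ.colLen 0 ≤ d)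
    (hs : μ.rowLen 0 ≤ s) :
    Nonempty (Representation.Equiv (schurRep μ ρ) (schurRep (complement μ d s) ρ')) := by
  obtain ⟨A, _, _, X, hX, hinj, hinj', hlift⟩ := exists_generic_matrix K d
  let Φ := rowEval (rowForms b X) μ
  let Φ' := rowEval (rowForms b' (rotInv X)) (complement μ d s)
  let D : A →ₗ[K] A := LinearMap.mulLeft K (X.det ^ s)
  have hΦ : Function.Injective Φ := rowEval_rowForms_injective b X hinj μ hd
  have hΦ' : Function.Injective (D ∘ₗ Φ') := by
    refine Function.Injective.comp (g := D) ?_ (rowEval_rowForms_injective b' (rotInv X) hinj' _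
      (colLen_complement_le μ d s 0))
    exact (hX.pow s).mul_right_injective
  have hmap : (schur K V μ).map Φ = (schur K U (complement μ d s)).map (D ∘ₗ Φ') := by
    rw [Submodule.map_comp, map_rowEval_schur b X μ s hs,
      map_rowEval_schur b' (rotInv X) _ s (rowLen_complement_le μ d s 0)]
    exact minorSpan_eq K hX s _ _ (fun j _ => (μ.colLen_anti 0 j (Nat.zero_le j)).trans hd)
      fun j hj => colLen_complement μ d s j hj
  obtain ⟨e, he⟩ := exists_equiv_of_map_eq Φ hΦ (D ∘ₗ Φ') hΦ' _ _ hmap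
  refine ⟨Representation.Equiv.mk e fun g => LinearMap.ext fun x => Subtype.ext (hΦ' ?_)⟩
  let P := (LinearMap.toMatrix b b (ρ g)).map (algebraMap K A)
  have hP : P.det = 1 := by
    have h1 : P = (algebraMap K A).mapMatrix (LinearMap.toMatrix b b (ρ g)) := rfl
    rw [h1, ← RingHom.map_det, LinearMap.det_toMatrix, hdet, map_one]
  -- The same `α` induces `g` on both sides: on `X` through `P`, on `rotInv X` through the inverse
  -- transpose of `P`.
  obtain ⟨α, hα⟩ := hlift (X * P) (by rwa [Matrix.det_mul, hP, mul_one])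
  have hα' : (rotInv X).map α = rotInv X *
      (LinearMap.toMatrix b' b' (ρ' g)).map (algebraMap K A) := by
    have h1 := map_rotInv (α : A →+* A) hX
    have h2 : X.map (α : A →+* A) = X * P := hα
    rw [h2, rotInv_mul] at h1
    refine h1.trans ?_
    rw [hdual]
    have h3 : P⁻¹ = (LinearMap.toMatrix b b (ρ g))⁻¹.map (algebraMap K A) := by
      refine Matrix.inv_eq_right_inv ?_
      rw [← Matrix.map_mul, Matrix.mul_nonsing_inv _ (by
        rw [LinearMap.det_toMatrix, hdet]
        exact isUnit_one), Matrix.map_one _ (map_zero _) (map_one _)]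
    rw [h3, Matrix.transpose_map]
  -- Determinant 1 is essential here: otherwise the factor `X.det ^ s` would twist the action by a
  -- power of the determinant character.
  have hαD (y : A) : α (D y) = D (α y) := by
    have h1 : α X.det = X.det := by
      have h2 : α X.det = (X.map α).det := by
        rw [AlgHom.map_det]
        rfl
      rw [h2, hα, Matrix.det_mul, hP, mul_one]
    simp [D, h1]
  have h1 : (D ∘ₗ Φ') (e (schurRep μ ρ g x)) = α (Φ x) := by
    rw [he]
    exact (map_rowEval_rowForms ρ b X g α hα μ x).symm
  have h2 : (D ∘ₗ Φ') (schurRep (complement μ d s) ρ' g (e x)) = α ((D ∘ₗ Φ') (e x)) := by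
    refine Eq.trans ?_ (hαD (Φ' (e x))).symm
    exact congrArg D (map_rowEval_rowForms ρ' b' (rotInv X) g α hα' _ _).symm
  exact h1.trans ((congrArg α (he x)).symm.trans h2.symm)

end Complement

/-! ### Characters of SL₂(K) with values in K -/

section SpecialLinear

variable {K : Type*} [Field K]

/-- The upper unitriangular matrix with off-diagonal entry `t`. -/
def upperUnip (t : K) : Matrix.SpecialLinearGroup (Fin 2) K :=
  ⟨!![1, t; 0, 1], by simp [Matrix.det_fin_two]⟩

/-- The lower unitriangular matrix with off-diagonal entry `t`. -/
def lowerUnip (t : K) : Matrix.SpecialLinearGroup (Fin 2) K :=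
  ⟨!![1, 0; t, 1], by simp [Matrix.det_fin_two]⟩

theorem coe_upperUnip (t : K) : (upperUnip t : Matrix (Fin 2) (Fin 2) K) = !![1, t; 0, 1] := rfl

theorem coe_lowerUnip (t : K) : (lowerUnip t : Matrix (Fin 2) (Fin 2) K) = !![1, 0; t, 1] := rfl

theorem upperUnip_add (s t : K) : upperUnip (s + t) = upperUnip s * upperUnip t := by
  refine Subtype.ext ?_
  rw [Matrix.SpecialLinearGroup.coe_mul]
  simp [coe_upperUnip, add_comm]

theorem upperUnip_zero : upperUnip (0 : K) = 1 := by
  refine Subtype.ext ?_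
  rw [Matrix.SpecialLinearGroup.coe_one, Matrix.one_fin_two, coe_upperUnip]

theorem upperUnip_natCast_mul (n : ℕ) (t : K) : upperUnip (n * t) = upperUnip t ^ n := by
  induction n with
  | zero => simp [upperUnip_zero]
  | succ n ih => rw [Nat.cast_succ, add_mul, one_mul, upperUnip_add, ih, pow_succ]

theorem exists_conj_upperUnip_eq (a t : K) (ha : a ≠ 0) :
    ∃ g : Matrix.SpecialLinearGroup (Fin 2) K, upperUnip (a * a * t) * g = g * upperUnip t := by
  obtain ⟨g, hg⟩ : ∃ g : Matrix.SpecialLinearGroup (Fin 2) K,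
      (g : Matrix (Fin 2) (Fin 2) K) = !![a, 0; 0, a⁻¹] :=
    ⟨⟨!![a, 0; 0, a⁻¹], by simp [Matrix.det_fin_two, ha]⟩, rfl⟩
  refine ⟨g, Subtype.ext ?_⟩
  rw [Matrix.SpecialLinearGroup.coe_mul, Matrix.SpecialLinearGroup.coe_mul, hg, coe_upperUnip,
    coe_upperUnip, Matrix.mul_fin_two, Matrix.mul_fin_two]
  ext i j
  fin_cases i <;> fin_cases j <;> simp
  field_simp

theorem exists_conj_lowerUnip_eq (t : K) :
    ∃ g : Matrix.SpecialLinearGroup (Fin 2) K, lowerUnip t * g = g * upperUnip (-t) := by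
  obtain ⟨g, hg⟩ : ∃ g : Matrix.SpecialLinearGroup (Fin 2) K,
      (g : Matrix (Fin 2) (Fin 2) K) = !![0, 1; -1, 0] :=
    ⟨⟨!![0, 1; -1, 0], by simp [Matrix.det_fin_two]⟩, rfl⟩
  refine ⟨g, Subtype.ext ?_⟩
  rw [Matrix.SpecialLinearGroup.coe_mul, Matrix.SpecialLinearGroup.coe_mul, hg, coe_upperUnip,
    coe_lowerUnip]
  simp

theorem eq_of_conj (χ : Matrix.SpecialLinearGroup (Fin 2) K →* K)
    {x y : Matrix.SpecialLinearGroup (Fin 2) K} (h : ∃ g, x * g = g * y) : χ x = χ y := by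
  obtain ⟨g, hg⟩ := h
  have h1 := congrArg χ hg
  rw [map_mul, map_mul, mul_comm] at h1
  exact ((Group.isUnit g).map χ).mul_left_cancel h1

/-- In characteristic p the matrix has p-th power 1, and 1 is the only p-th root of unity in K. In
characteristic 0, conjugation by diag(n, n⁻¹) multiplies `t` by n², so the value x satisfies x^(n²)
= x; n = 2 and n = 3 give x³ = 1 = x⁸, hence x = 1. -/
theorem map_upperUnip (χ : Matrix.SpecialLinearGroup (Fin 2) K →* K) (t : K) :
    χ (upperUnip t) = 1 := by
  have hpow (n : ℕ) : χ (upperUnip (n * t)) = χ (upperUnip t) ^ n := by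
    rw [upperUnip_natCast_mul, map_pow]
  have hne : χ (upperUnip t) ≠ 0 := ((Group.isUnit _).map χ).ne_zero
  obtain ⟨p, hp⟩ := CharP.exists K
  rcases CharP.char_is_prime_or_zero K p with hprime | rfl
  · have h1 := hpow p
    rw [CharP.cast_eq_zero, zero_mul, upperUnip_zero, map_one] at h1
    have := Fact.mk hprime
    exact frobenius_inj K p (by rw [frobenius_def, frobenius_def, one_pow, ← h1])
  · have := CharP.charP_to_charZero K
    have hconj (n : ℕ) (hn : n ≠ 0) : χ (upperUnip t) ^ (n * n) = χ (upperUnip t) := by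
      rw [← hpow, Nat.cast_mul]
      exact eq_of_conj χ (exists_conj_upperUnip_eq _ _ (Nat.cast_ne_zero.2 hn))
    have h2 := hconj 2 two_ne_zero
    have h3 := hconj 3 three_ne_zero
    generalize χ (upperUnip t) = x at h2 h3 hne
    have h2' : x ^ 3 = 1 := mul_right_cancel₀ hne (by linear_combination h2)
    have h3' : x ^ 8 = 1 := mul_right_cancel₀ hne (by linear_combination h3)
    linear_combination (x ^ 6 + x ^ 3 + 1) * h2' - x * h3'

/-- `SL₂(K)` has no nontrivial character with values in `K`. -/
theorem specialLinearGroup_character_eq_one (χ : Matrix.SpecialLinearGroup (Fin 2) K →* K)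
    (g : Matrix.SpecialLinearGroup (Fin 2) K) : χ g = 1 := by
  have hl (t : K) : χ (lowerUnip t) = 1 :=
    (eq_of_conj χ (exists_conj_lowerUnip_eq t)).trans (map_upperUnip χ _)
  have key (g : Matrix.SpecialLinearGroup (Fin 2) K) (hg : g.1 1 0 ≠ 0) : χ g = 1 := by
    have hdet := g.2
    rw [Matrix.det_fin_two] at hdet
    have : g = upperUnip ((g.1 0 0 - 1) / g.1 1 0) * lowerUnip (g.1 1 0) *
        upperUnip ((g.1 1 1 - 1) / g.1 1 0) := by
      refine Subtype.ext ?_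
      rw [Matrix.SpecialLinearGroup.coe_mul, Matrix.SpecialLinearGroup.coe_mul, coe_upperUnip,
        coe_upperUnip, coe_lowerUnip, Matrix.mul_fin_two, Matrix.mul_fin_two]
      refine (Matrix.eta_fin_two g.1).trans ?_
      congr! 5 <;> field_simp
      · ring
      · linear_combination -hdet
      · ring
      · ring
    rw [this, map_mul, map_mul, hl, map_upperUnip, map_upperUnip, mul_one, mul_one]
  by_cases hg : g.1 1 0 = 0
  · have hdet := g.2
    rw [Matrix.det_fin_two, hg, mul_zero, sub_zero] at hdet
    have h0 : g.1 0 0 ≠ 0 := left_ne_zero_of_mul (hdet ▸ one_ne_zero)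
    -- Adding the first row to the second makes the lower left entry nonzero without changing the
    -- value of `χ`.
    have h1 : χ (lowerUnip 1 * g) = 1 := by
      refine key _ ?_
      rw [Matrix.SpecialLinearGroup.coe_mul, coe_lowerUnip]
      simpa [Matrix.mul_apply, Fin.sum_univ_two, hg] using h0
    rwa [map_mul, hl, one_mul] at h1
  · exact key g hg

theorem det_representation_eq_one {V : Type*} [AddCommGroup V] [Module K V]
    (ρ : Representation K (Matrix.SpecialLinearGroup (Fin 2) K) V)
    (g : Matrix.SpecialLinearGroup (Fin 2) K) : LinearMap.det (ρ g) = 1 :=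
  specialLinearGroup_character_eq_one ((LinearMap.det : (V →ₗ[K] V) →* K).comp ρ) g

end SpecialLinear

/-! ### Duality between the lower and upper symmetric powers -/

section Pairing

variable (K : Type*) [Field K]

/-- This form is scaled by det g under g, so it is SL₂-invariant and makes E self-dual. -/
theorem exists_detForm : ∃ φ : (Fin 2 → K) ≃ₗ[K] Module.Dual K (Fin 2 → K),
    ∀ u v, φ u v = u 0 * v 1 - u 1 * v 0 := by
  let f : (Fin 2 → K) →ₗ[K] Module.Dual K (Fin 2 → K) :=
    LinearMap.mk₂ K (fun u v => u 0 * v 1 - u 1 * v 0)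
      (fun _ _ _ => by simp only [Pi.add_apply]; ring)
      (fun _ _ _ => by simp only [Pi.smul_apply, smul_eq_mul]; ring)
      (fun _ _ _ => by simp only [Pi.add_apply]; ring)
      (fun _ _ _ => by simp only [Pi.smul_apply, smul_eq_mul]; ring)
  have hf : ∀ u v, f u v = u 0 * v 1 - u 1 * v 0 := fun _ _ => rfl
  refine ⟨LinearEquiv.ofInjectiveOfFinrankEq f ?_ (Subspace.dual_finrank_eq).symm, hf⟩
  rw [injective_iff_map_eq_zero]
  intro u hu
  have h0 := hf u ![0, 1]
  have h1 := hf u ![1, 0]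
  rw [hu] at h0 h1
  ext i
  fin_cases i
  · simpa using h0.symm
  · simpa using h1.symm

/-- The perfect pairing on `E^{⊗r}` induced by the determinant form on `E`. -/
theorem exists_tensorPairing (r : ℕ) :
    ∃ T : (⨂[K]^r (Fin 2 → K)) ≃ₗ[K] Module.Dual K (⨂[K]^r (Fin 2 → K)),
      (∀ (σ : Equiv.Perm (Fin r)) x y,
        T (placePerm K _ r σ x) (placePerm K _ r σ y) = T x y) ∧
      ∀ g x y, T (tensorPowerRep (naturalRep K) r g x) (tensorPowerRep (naturalRep K) r g y) =
        T x y := by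
  obtain ⟨φ, hφ⟩ := exists_detForm K
  let T := (PiTensorProduct.congr fun _ : Fin r => φ).trans
    (PiTensorProduct.dualDistribEquiv (R := K) (M := fun _ : Fin r => Fin 2 → K))
  have hT (u v : Fin r → Fin 2 → K) :
      T (PiTensorProduct.tprod K u) (PiTensorProduct.tprod K v) = ∏ i, φ (u i) (v i) := by
    simp only [T, LinearEquiv.trans_apply, PiTensorProduct.congr_tprod]
    exact PiTensorProduct.dualDistrib_apply _ _
  have hext (F : (⨂[K]^r (Fin 2 → K)) →ₗ[K] (⨂[K]^r (Fin 2 → K)))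
      (h : ∀ u v, T (F (PiTensorProduct.tprod K u)) (F (PiTensorProduct.tprod K v)) =
        T (PiTensorProduct.tprod K u) (PiTensorProduct.tprod K v)) (x y : _) :
      T (F x) (F y) = T x y := by
    have : (T.toLinearMap.compl₁₂ F F) = T.toLinearMap := by
      refine PiTensorProduct.ext (MultilinearMap.ext fun u => ?_)
      refine PiTensorProduct.ext (MultilinearMap.ext fun v => ?_)
      exact h u v
    exact LinearMap.congr_fun (LinearMap.congr_fun this x) y
  refine ⟨T, fun σ => hext _ fun u v => ?_, fun g => hext _ fun u v => ?_⟩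
  · rw [placePerm_tprod, placePerm_tprod, hT, hT]
    exact Equiv.prod_comp σ.symm fun i => φ (u i) (v i)
  · rw [tensorPowerRep_tprod, tensorPowerRep_tprod, hT, hT]
    refine Finset.prod_congr rfl fun i _ => ?_
    have hdet := g.2
    rw [Matrix.det_fin_two] at hdet
    simp only [hφ, naturalRep, MonoidHom.coe_mk, OneHom.coe_mk, Matrix.toLin'_apply,
      Matrix.mulVec, dotProduct, Fin.sum_univ_two]
    linear_combination (u i 0 * v i 1 - u i 1 * v i 0) * hdet

/-- `Sym_r E` is isomorphic to the dual of `Sym^r E` as a representation of `SL₂(K)`. -/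
theorem exists_symLower_equiv_dual (r : ℕ) :
    ∃ Θ : SymLower K (Fin 2 → K) r ≃ₗ[K] Module.Dual K (SymUpper K (Fin 2 → K) r),
      ∀ g x y, Θ (symLowerRep (naturalRep K) r g x) y =
        Θ x (symUpperRep (naturalRep K) r g⁻¹ y) := by
  obtain ⟨T, hσ, hg⟩ := exists_tensorPairing K r
  have hinv (x : SymLower K (Fin 2 → K) r) (σ : Equiv.Perm (Fin r)) :
      T x ∘ₗ placePerm K _ r σ = T x := by
    refine LinearMap.ext fun y => ?_
    have h := hσ σ x y
    rwa [x.2 σ] at h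
  -- Pairing with an invariant tensor is an invariant functional, so it descends to the
  -- coinvariants.
  let f : SymLower K (Fin 2 → K) r →ₗ[K] Module.Dual K (SymUpper K (Fin 2 → K) r) :=
    { toFun := fun x => Representation.Coinvariants.lift _ (T x) (hinv x)
      map_add' := fun x y => by
        refine Representation.Coinvariants.hom_ext (LinearMap.ext fun z => ?_)
        simp
      map_smul' := fun c x => by
        refine Representation.Coinvariants.hom_ext (LinearMap.ext fun z => ?_)
        simp }
  have hf (x : SymLower K (Fin 2 → K) r) (y : ⨂[K]^r (Fin 2 → K)) :
      f x (Representation.Coinvariants.mk _ y) = T x y := rfl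
  refine ⟨LinearEquiv.ofBijective f ⟨?_, fun ξ => ?_⟩, fun g x y => ?_⟩
  · rw [injective_iff_map_eq_zero]
    intro x hx
    refine Subtype.ext (T.map_eq_zero_iff.1 (LinearMap.ext fun y => ?_))
    rw [← hf, hx]
    rfl
  · let η := ξ ∘ₗ Representation.Coinvariants.mk (placePerm K (Fin 2 → K) r)
    have hη (σ : Equiv.Perm (Fin r)) (y : ⨂[K]^r (Fin 2 → K)) :
        η (placePerm K _ r σ y) = η y :=
      congrArg ξ ((Representation.Coinvariants.mk_eq_iff _).2
        (Submodule.subset_span ⟨(σ, y), rfl⟩))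
    -- Conversely, the tensor representing an invariant functional is invariant, because the pairing
    -- is perfect and invariant.
    refine ⟨⟨T.symm η, fun σ => T.injective (LinearMap.ext fun y => ?_)⟩, ?_⟩
    · have h := hσ σ (T.symm η) (placePerm K _ r σ⁻¹ y)
      rw [Representation.self_inv_apply, LinearEquiv.apply_symm_apply, hη] at h
      rw [h, LinearEquiv.apply_symm_apply]
    · refine Representation.Coinvariants.hom_ext (LinearMap.ext fun y => ?_)
      refine (hf _ y).trans ?_
      rw [LinearEquiv.apply_symm_apply]
  · obtain ⟨y, rfl⟩ := Representation.Coinvariants.mk_surjective _ y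
    have h := hg g x (tensorPowerRep (naturalRep K) r g⁻¹ y)
    rw [Representation.self_inv_apply] at h
    exact h

end Pairing

end ModularPlethysm

end

/-! ### The isomorphism for symmetric powers of E -/

theorem corollary1p2 (K : Type*) [Field K] (l s : ℕ) (μ : YoungDiagram)
    (hlength : μ.colLen 0 ≤ l + 1) (hfirst : μ.rowLen 0 ≤ s) :
    Nonempty (Representation.Equiv
      (ModularPlethysm.schurRep μ
        (ModularPlethysm.symUpperRep (ModularPlethysm.naturalRep K) l))
      (ModularPlethysm.schurRep (ModularPlethysm.complement μ (l + 1) s)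
        (V := ModularPlethysm.SymLower K (Fin 2 → K) l)
        (ModularPlethysm.symLowerRep (ModularPlethysm.naturalRep K) l))) := by
  obtain ⟨b⟩ := ModularPlethysm.nonempty_basis_symUpper (Pi.basisFun K (Fin 2)) l
  obtain ⟨Θ, hΘ⟩ := ModularPlethysm.exists_symLower_equiv_dual K l
  have hdual (x : ModularPlethysm.SymLower K (Fin 2 → K) l) (i : Fin (l + 1)) :
      (b.dualBasis.map Θ.symm).repr x i = Θ x (b i) := by
    simp
  -- In the dual basis carried over by `Θ`, the matrix of `g` on the lower power is the transpose of
  -- that of `g⁻¹` on the upper power.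
  refine ModularPlethysm.schurRep_equiv_complement _ _ b (b.dualBasis.map Θ.symm) (fun g => ?_)
    (ModularPlethysm.det_representation_eq_one _) μ s hlength hfirst
  have hinv : (LinearMap.toMatrix b b
      (ModularPlethysm.symUpperRep (ModularPlethysm.naturalRep K) l g))⁻¹ = LinearMap.toMatrix b b
        (ModularPlethysm.symUpperRep (ModularPlethysm.naturalRep K) l g⁻¹) := by
    refine Matrix.inv_eq_right_inv ?_
    rw [← LinearMap.toMatrix_mul, ← map_mul, mul_inv_cancel, map_one, LinearMap.toMatrix_one]
  rw [hinv]
  ext i k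
  rw [LinearMap.toMatrix_apply, hdual, hΘ, Matrix.transpose_apply, LinearMap.toMatrix_apply]
  simp
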